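/- Let $X$ be a non-empty metric space with metric $d$. For $\varepsilon>0$, an $\varepsilon$-chain is a finite sequence $\{x_0,\dots,x_n\}$ of points of $X$ with $d(x_{i-1},x_i)<\varepsilon$ for all $i$; it is an $\varepsilon$-loop if $x_0=x_n$. A basic move on an $\varepsilon$-chain adds or removes a single point, keeping the two endpoints fixed, so that the result is again an $\varepsilon$-chain; two $\varepsilon$-chains are $\varepsilon$-homotopic if they are connected by finitely many basic moves, and an $\varepsilon$-loop based at $x$ is $\varepsilon$-null if it is $\varepsilon$-homotopic to the trivial loop $\{x\}$. For a base point $p\in X$ let $X_\varepsilon$ be the set of $\varepsilon$-homotopy classes $[\alpha]_\varepsilon$ of $\varepsilon$-chains $\alpha$ beginning at $p$, and for $0<\delta<\varepsilon$ let $\varphi_{\varepsilon\delta}:X_\delta\to X_\varepsilon$, $[\alpha]_\delta\mapsto[\alpha]_\varepsilon$. A non-critical interval is a non-empty open interval $I\subset(0,\infty)$ such that $\varphi_{\varepsilon\delta}$ is bijective for all $\delta<\varepsilon$ in $I$. The critical spectrum $Cr(X)$ is the set of all $\varepsilon>0$ that lie in no non-critical interval. The homotopy critical spectrum $H(X)$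 is the set of all $\varepsilon>0$ for which there is an $\varepsilon$-loop in $X$ (based at any point) that is not $\varepsilon$-null but is $\delta$-null for every $\delta>\varepsilon$. The space $X$ is geodesic if any two points $x,y\in X$ are joined by an arclength parameterized curve of length $d(x,y)$. If $X$ is geodesic, then, for every choice of the base point, $Cr(X)=\overline{H(X)}$, where the closure is taken in $(0,\infty)$. If $X$ is moreover compact, then $Cr(X)=H(X)$. -/

import Mathlib

namespace DiscreteHomotopy

/-- A metric space is geodesic if any two points `x`, `y` are joined by a geodesic: a curve
`γ : [0, L] → X` from `x` to `y`, parameterized by arclength, whose length is `d(x, y)`. -/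
def IsGeodesicSpace (X : Type*) [MetricSpace X] : Prop :=
  ∀ x y : X, ∃ (L : ℝ) (γ : ℝ → X), 0 ≤ L ∧ ContinuousOn γ (Set.Icc 0 L) ∧
    γ 0 = x ∧ γ L = y ∧ HasUnitSpeedOn γ (Set.Icc 0 L) ∧
    eVariationOn γ (Set.Icc 0 L) = edist x y

section Chains

variable {X : Type*} [MetricSpace X]

/-- An `ε`-chain `{x₀, …, xₙ}`: a non-empty finite sequence with `d(xᵢ₋₁, xᵢ) < ε`. -/
def IsEpsChain (ε : ℝ) (α : List X) : Prop :=
  α ≠ [] ∧ α.IsChain (fun x y => dist x y < ε)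

/-- `β` arises from `α` by inserting a single point, the two endpoints being unchanged. -/
def AddsPoint (α β : List X) : Prop :=
  (∃ (l₁ l₂ : List X) (z : X), α = l₁ ++ l₂ ∧ β = l₁ ++ z :: l₂) ∧
    α.head? = β.head? ∧ α.getLast? = β.getLast?

/-- A basic move between `ε`-chains: the addition or the removal of a single point, with the
endpoints fixed, both sequences being `ε`-chains. -/
def BasicMove (ε : ℝ) (α β : List X) : Prop :=
  IsEpsChain ε α ∧ IsEpsChain ε β ∧ (AddsPoint α β ∨ AddsPoint β α)

/-- `ε`-homotopy: a finite sequence of basic moves. (Only used between `ε`-chains.) -/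
def EpsHomotopic (ε : ℝ) (α β : List X) : Prop :=
  Relation.ReflTransGen (BasicMove ε) α β

/-- An `ε`-loop is an `ε`-chain with equal initial and terminal points. -/
def IsEpsLoop (ε : ℝ) (γ : List X) : Prop :=
  IsEpsChain ε γ ∧ γ.head? = γ.getLast?

/-- A loop is `ε`-null if it is `ε`-homotopic to the trivial loop at its base point. -/
def IsEpsNull (ε : ℝ) (γ : List X) : Prop :=
  ∃ x : X, γ.head? = some x ∧ EpsHomotopic ε γ [x]

theorem IsEpsChain.mono {δ ε : ℝ} (h : δ ≤ ε) {α : List X} (hα : IsEpsChain δ α) :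
    IsEpsChain ε α :=
  ⟨hα.1, hα.2.imp fun _ _ hab => lt_of_lt_of_le hab h⟩

theorem BasicMove.mono {δ ε : ℝ} (h : δ ≤ ε) {α β : List X} (hm : BasicMove δ α β) :
    BasicMove ε α β :=
  ⟨hm.1.mono h, hm.2.1.mono h, hm.2.2⟩

theorem EpsHomotopic.mono {δ ε : ℝ} (h : δ ≤ ε) {α β : List X} (hh : EpsHomotopic δ α β) :
    EpsHomotopic ε α β :=
  Relation.ReflTransGen.mono (fun _ _ hm => BasicMove.mono h hm) _ _ hh

theorem BasicMove.symm {ε : ℝ} {α β : List X} (h : BasicMove ε α β) : BasicMove ε β α :=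
  ⟨h.2.1, h.1, h.2.2.symm⟩

theorem EpsHomotopic.equivalence (ε : ℝ) :
    Equivalence (EpsHomotopic ε : List X → List X → Prop) where
  refl _ := Relation.ReflTransGen.refl
  symm {_ _} h := by
    induction h with
    | refl => exact Relation.ReflTransGen.refl
    | tail _ hm ih => exact Relation.ReflTransGen.head hm.symm ih
  trans h₁ h₂ := Relation.ReflTransGen.trans h₁ h₂

/-- The `ε`-chains beginning at the base point `p`. -/
abbrev ChainFrom (p : X) (ε : ℝ) : Type _ :=
  {α : List X // IsEpsChain ε α ∧ α.head? = some p}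

/-- `ε`-homotopy as an equivalence relation on the `ε`-chains beginning at `p`. -/
def chainSetoid (p : X) (ε : ℝ) : Setoid (ChainFrom p ε) where
  r α β := EpsHomotopic ε α.1 β.1
  iseqv :=
    { refl := fun α => (EpsHomotopic.equivalence ε).refl α.1
      symm := fun h => (EpsHomotopic.equivalence ε).symm h
      trans := fun h₁ h₂ => (EpsHomotopic.equivalence ε).trans h₁ h₂ }

/-- The (underlying set of the) `ε`-cover `X_ε`: the `ε`-homotopy classes of `ε`-chains
beginning at the base point `p`. -/
def EpsCover (p : X) (ε : ℝ) : Type _ :=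
  Quotient (chainSetoid p ε)

/-- The map `φ_{εδ} : X_δ → X_ε`, `[α]_δ ↦ [α]_ε`. -/
def coverMap (p : X) {δ ε : ℝ} (h : δ ≤ ε) : EpsCover p δ → EpsCover p ε :=
  Quotient.map' (s₁ := chainSetoid p δ) (s₂ := chainSetoid p ε)
    (fun α => ⟨α.1, α.2.1.mono h, α.2.2⟩)
    (fun _ _ hαβ => EpsHomotopic.mono h hαβ)

/-- A non-critical interval: a non-empty open interval `I ⊆ (0, ∞)` such that
`φ_{εδ} : X_δ → X_ε` is bijective for all `δ < ε` in `I`. -/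
def IsNoncriticalInterval (p : X) (I : Set ℝ) : Prop :=
  I.Nonempty ∧ IsOpen I ∧ I.OrdConnected ∧ I ⊆ Set.Ioi 0 ∧
    ∀ δ ∈ I, ∀ ε ∈ I, ∀ h : δ < ε, Function.Bijective (coverMap p h.le)

/-- The critical spectrum `Cr(X)` (computed with the base point `p`): the positive numbers that
lie in no non-critical interval. -/
def criticalSpectrum (p : X) : Set ℝ :=
  {ε | 0 < ε ∧ ¬ ∃ I : Set ℝ, IsNoncriticalInterval p I ∧ ε ∈ I}

end Chains

/-- The homotopy critical spectrum `H(X)`: the numbers `ε > 0` for which there is an `ε`-loop (based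
at any point) that is not `ε`-null but is `δ`-null for all `δ > ε`. -/
def homotopyCriticalSpectrum (X : Type*) [MetricSpace X] : Set ℝ :=
  {ε | 0 < ε ∧ ∃ γ : List X, IsEpsLoop ε γ ∧ ¬ IsEpsNull ε γ ∧ ∀ δ, ε < δ → IsEpsNull δ γ}

end DiscreteHomotopy

namespace DiscreteHomotopy

variable {X : Type*}

/-! Inserting midpoints refines a chain within its homotopy class, so every `coverMap` is surjective
(`coverMap_surjective`) and criticality is failure of injectivity. If two chains are homotopic at
scale `t` but not at `δ < t`, there is a largest scale `s` in `[δ, t)` at which they are not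
(`exists_critical_scale`): a homotopy involves finitely many strict inequalities, so it survives a
slight decrease of scale. The loop `α⁻¹β` then puts `s` in H(X), so an interval missing H(X) is
non-critical. Conversely, a loop witnessing `ε ∈ H(X)`, joined to the base point, breaks injectivity
just above `ε`.

In the compact case H(X) ∩ [a, ∞) is finite for `a > 0`. Record which triples of a finite net lie
near triangles with sides `< s`. If `s < t` give the same record, triangles at scale `t` are close
to triangles at scale `s`, and subdivision turns a null-homotopy slightly above `s` into one at `s`
(`IsEpsNull.of_trianglesApprox`). Hence the record is injective on H(X) ∩ [a, ∞). -/

theorem AddsPoint.append {α β : List X} (h : AddsPoint α β) (l₁ l₂ : List X) :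
    AddsPoint (l₁ ++ α ++ l₂) (l₁ ++ β ++ l₂) := by
  obtain ⟨⟨a, b, z, rfl, rfl⟩, hh, hl⟩ := h
  refine ⟨⟨l₁ ++ a, b ++ l₂, z, by simp, by simp⟩, ?_, ?_⟩
  · simp only [List.head?_append, hh]
  · simp only [List.getLast?_append, hl]

/-- Insert `m x y` between any two consecutive points `x`, `y`. -/
def subdivide (m : X → X → X) : List X → List X
  | [] => []
  | [x] => [x]
  | x :: y :: l => x :: m x y :: subdivide m (y :: l)

theorem exists_subdivide_eq_cons (m : X → X → X) (x : X) (l : List X) :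
    ∃ l', subdivide m (x :: l) = x :: l' := by
  cases l with
  | nil => exact ⟨[], rfl⟩
  | cons y l => exact ⟨_, rfl⟩

variable [MetricSpace X] {ε : ℝ} {m : X → X → X}

/-! ### Endpoints, concatenation and reversal of chains. -/

theorem BasicMove.head?_eq {α β : List X} (h : BasicMove ε α β) : α.head? = β.head? := by
  rcases h.2.2 with h | h
  · exact h.2.1
  · exact h.2.1.symm

theorem BasicMove.getLast?_eq {α β : List X} (h : BasicMove ε α β) :
    α.getLast? = β.getLast? := by
  rcases h.2.2 with h | h
  · exact h.2.2
  · exact h.2.2.symm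

theorem EpsHomotopic.head?_eq {α β : List X} (h : EpsHomotopic ε α β) : α.head? = β.head? := by
  induction h with
  | refl => rfl
  | tail _ hm ih => exact ih.trans hm.head?_eq

theorem EpsHomotopic.getLast?_eq {α β : List X} (h : EpsHomotopic ε α β) :
    α.getLast? = β.getLast? := by
  induction h with
  | refl => rfl
  | tail _ hm ih => exact ih.trans hm.getLast?_eq

theorem EpsHomotopic.symm {α β : List X} (h : EpsHomotopic ε α β) : EpsHomotopic ε β α :=
  (EpsHomotopic.equivalence ε).symm h

theorem EpsHomotopic.trans {α β γ : List X} (h : EpsHomotopic ε α β) (h' : EpsHomotopic ε β γ) :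
    EpsHomotopic ε α γ :=
  (EpsHomotopic.equivalence ε).trans h h'

theorem EpsHomotopic.refl (α : List X) : EpsHomotopic ε α α :=
  Relation.ReflTransGen.refl

theorem EpsHomotopic.isEpsChain {α β : List X} (h : EpsHomotopic ε α β) (hα : IsEpsChain ε α) :
    IsEpsChain ε β := by
  induction h with
  | refl => exact hα
  | tail _ hm _ => exact hm.2.1

/-- Replacing a sub-chain by a chain with the same endpoints. -/
theorem IsEpsChain.replace {α β l₁ l₂ : List X} (hβ : IsEpsChain ε β)
    (hh : α.head? = β.head?) (hl : α.getLast? = β.getLast?)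
    (hc : IsEpsChain ε (l₁ ++ α ++ l₂)) : IsEpsChain ε (l₁ ++ β ++ l₂) := by
  refine ⟨by simp [hβ.1], ?_⟩
  have h := hc.2
  rw [List.isChain_append, List.isChain_append] at h ⊢
  obtain ⟨⟨h1, _, h3⟩, h4, h5⟩ := h
  refine ⟨⟨h1, hβ.2, ?_⟩, h4, ?_⟩
  · rwa [← hh]
  · rw [List.getLast?_append] at h5 ⊢
    rwa [← hl]

theorem EpsHomotopic.append {α β : List X} (h : EpsHomotopic ε α β) (l₁ l₂ : List X)
    (hc : IsEpsChain ε (l₁ ++ α ++ l₂)) :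
    EpsHomotopic ε (l₁ ++ α ++ l₂) (l₁ ++ β ++ l₂) := by
  induction h with
  | refl => exact .refl _
  | tail _ hm ih =>
    have hb := ih.isEpsChain hc
    refine ih.tail ⟨hb, hm.2.1.replace hm.head?_eq hm.getLast?_eq hb, ?_⟩
    exact hm.2.2.imp (fun h => h.append l₁ l₂) (fun h => h.append l₁ l₂)

theorem EpsHomotopic.append_left {α β : List X} (h : EpsHomotopic ε α β) (l : List X)
    (hc : IsEpsChain ε (l ++ α)) : EpsHomotopic ε (l ++ α) (l ++ β) := by
  simpa using h.append l [] (by simpa using hc)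

theorem EpsHomotopic.append_right {α β : List X} (h : EpsHomotopic ε α β) (l : List X)
    (hc : IsEpsChain ε (α ++ l)) : EpsHomotopic ε (α ++ l) (β ++ l) := by
  simpa using h.append [] l (by simpa using hc)

theorem EpsHomotopic.cons {α β : List X} (h : EpsHomotopic ε α β) (x : X)
    (hc : IsEpsChain ε (x :: α)) : EpsHomotopic ε (x :: α) (x :: β) :=
  h.append_left [x] hc

theorem isEpsChain_singleton (x : X) : IsEpsChain ε [x] := ⟨by simp, by simp⟩

theorem isEpsChain_cons_cons {x y : X} {l : List X} :
    IsEpsChain ε (x :: y :: l) ↔ dist x y < ε ∧ IsEpsChain ε (y :: l) := by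
  simp [IsEpsChain]

/-- A point whose two neighbours are `ε`-close may be removed. -/
theorem epsHomotopic_remove {a z b : X} {l : List X} (hc : IsEpsChain ε (a :: z :: b :: l))
    (hab : dist a b < ε) : EpsHomotopic ε (a :: z :: b :: l) (a :: b :: l) := by
  have hc' : IsEpsChain ε (a :: b :: l) := by
    simp only [isEpsChain_cons_cons] at hc ⊢
    exact ⟨hab, hc.2.2⟩
  exact .single ⟨hc, hc', .inr ⟨⟨[a], b :: l, z, rfl, rfl⟩, rfl, by simp⟩⟩

/-- A repeated point may be removed. -/
theorem epsHomotopic_dup {a : X} {l : List X} (hc : IsEpsChain ε (a :: a :: l)) :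
    EpsHomotopic ε (a :: a :: l) (a :: l) :=
  .single ⟨hc, (isEpsChain_cons_cons.1 hc).2, .inr ⟨⟨[a], l, a, rfl, rfl⟩, rfl, by simp⟩⟩

theorem IsEpsChain.append {α β : List X} {x : X} (hε : 0 < ε) (hα : IsEpsChain ε α)
    (hβ : IsEpsChain ε β) (h : α.getLast? = some x) (h' : β.head? = some x) :
    IsEpsChain ε (α ++ β) := by
  refine ⟨by simp [hα.1], List.isChain_append.2 ⟨hα.2, hβ.2, ?_⟩⟩
  intro a ha b hb
  simp_all

theorem IsEpsChain.reverse {α : List X} (hα : IsEpsChain ε α) : IsEpsChain ε α.reverse := by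
  refine ⟨by simp [hα.1], List.isChain_reverse.2 ?_⟩
  simpa [dist_comm, flip] using hα.2

theorem epsHomotopic_singleton_append {x : X} {β : List X} (hε : 0 < ε) (hβ : IsEpsChain ε β)
    (h : β.head? = some x) : EpsHomotopic ε ([x] ++ β) β := by
  obtain ⟨l, rfl⟩ : ∃ l, β = x :: l := by
    cases β with
    | nil => simp at h
    | cons y l => simp at h; exact ⟨l, by rw [h]⟩
  exact epsHomotopic_dup ((isEpsChain_singleton x).append hε hβ rfl rfl)

theorem epsHomotopic_append_singleton {x : X} {α : List X} (hε : 0 < ε) (hα : IsEpsChain ε α)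
    (h : α.getLast? = some x) : EpsHomotopic ε (α ++ [x]) α := by
  obtain ⟨l, rfl⟩ : ∃ l, α = l ++ [x] := by
    rw [List.getLast?_eq_some_iff] at h; exact h
  have hc := hα.append hε (isEpsChain_singleton x) h rfl
  rw [List.append_assoc] at hc ⊢
  refine EpsHomotopic.append_left (epsHomotopic_dup ?_) l hc
  exact isEpsChain_cons_cons.2 ⟨by simpa using hε, isEpsChain_singleton x⟩

/-- A chain followed by its reversal is null. -/
theorem epsHomotopic_append_reverse {α : List X} {x : X} (hε : 0 < ε) (hα : IsEpsChain ε α)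
    (h : α.head? = some x) : EpsHomotopic ε (α ++ α.reverse) [x] := by
  induction α generalizing x with
  | nil => simp at h
  | cons y l ih =>
    obtain rfl : y = x := by simpa using h
    have hc : IsEpsChain ε ((y :: l) ++ (y :: l).reverse) := by
      obtain ⟨z, hz⟩ : ∃ z, (y :: l).getLast? = some z := ⟨_, List.getLast?_eq_some_getLast hα.1⟩
      exact hα.append hε hα.reverse hz (by rw [List.head?_reverse, hz])
    cases l with
    | nil => exact epsHomotopic_dup hc
    | cons z l =>
      obtain ⟨hyz, hz⟩ := isEpsChain_cons_cons.1 hα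
      have e : (y :: z :: l) ++ (y :: z :: l).reverse
          = [y] ++ ((z :: l) ++ (z :: l).reverse) ++ [y] := by simp
      rw [e] at hc ⊢
      have hm := (ih hz rfl).append [y] [y] hc
      refine hm.trans ((epsHomotopic_remove (hm.isEpsChain hc) (by simpa using hε)).trans
        (epsHomotopic_dup ?_))
      exact isEpsChain_cons_cons.2 ⟨by simpa using hε, isEpsChain_singleton y⟩

theorem epsHomotopic_reverse_append {α : List X} {x : X} (hε : 0 < ε) (hα : IsEpsChain ε α)
    (h : α.getLast? = some x) : EpsHomotopic ε (α.reverse ++ α) [x] := by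
  simpa using epsHomotopic_append_reverse hε hα.reverse (by rwa [List.head?_reverse])

/-! ### Openness of the homotopy relation in the scale -/

theorem IsEpsChain.exists_lt {α : List X} (h : IsEpsChain ε α) :
    ∃ r < ε, ∀ s, r < s → IsEpsChain s α := by
  induction α with
  | nil => exact absurd rfl h.1
  | cons x l ih =>
    cases l with
    | nil => exact ⟨ε - 1, by linarith, fun s _ => isEpsChain_singleton x⟩
    | cons y l =>
      obtain ⟨hxy, hl⟩ := isEpsChain_cons_cons.1 h
      obtain ⟨r, hr, hs⟩ := ih hl
      exact ⟨max r (dist x y), max_lt hr hxy, fun s h => isEpsChain_cons_cons.2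
        ⟨(le_max_right _ _).trans_lt h, hs s ((le_max_left _ _).trans_lt h)⟩⟩

theorem EpsHomotopic.exists_lt {α β : List X} (h : EpsHomotopic ε α β) :
    ∃ r < ε, ∀ s, r < s → EpsHomotopic s α β := by
  induction h with
  | refl => exact ⟨ε - 1, by linarith, fun s _ => .refl _⟩
  | tail _ hm ih =>
    obtain ⟨r, hr, h⟩ := ih
    obtain ⟨r₁, hr₁, h₁⟩ := hm.1.exists_lt
    obtain ⟨r₂, hr₂, h₂⟩ := hm.2.1.exists_lt
    refine ⟨max r (max r₁ r₂), by simp [*], fun s hs => ?_⟩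
    simp only [max_lt_iff] at hs
    exact (h s hs.1).tail ⟨h₁ s hs.2.1, h₂ s hs.2.2, hm.2.2⟩

/-- The last scale at which two chains fail to be homotopic. -/
theorem exists_critical_scale {α β : List X} {δ t : ℝ} (ht : EpsHomotopic t α β)
    (hδ : ¬ EpsHomotopic δ α β) :
    ∃ s, δ ≤ s ∧ s < t ∧ ¬ EpsHomotopic s α β ∧ ∀ r, s < r → EpsHomotopic r α β := by
  set S : Set ℝ := {r | ¬ EpsHomotopic r α β}
  have hb : ∀ r ∈ S, r ≤ t := fun r hr => by
    by_contra! hlt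
    exact hr (ht.mono hlt.le)
  have hbdd : BddAbove S := ⟨t, hb⟩
  -- A homotopy at the supremum would persist at some smaller scales, among them elements of `S`.
  have hs : ¬ EpsHomotopic (sSup S) α β := by
    intro h
    obtain ⟨r, hr, h⟩ := h.exists_lt
    obtain ⟨u, hu, hru⟩ := exists_lt_of_lt_csSup ⟨δ, hδ⟩ hr
    exact hu (h u hru)
  refine ⟨sSup S, le_csSup hbdd hδ, lt_of_le_of_ne (csSup_le ⟨δ, hδ⟩ hb) ?_, hs, ?_⟩
  · rintro h
    exact hs (h ▸ ht)
  · intro r hr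
    by_contra hn
    exact hr.not_ge (le_csSup hbdd hn)

/-- Two chains from the same point that are homotopic at all scales above `s` but not at `s`
produce an element of the homotopy critical spectrum. -/
theorem mem_homotopyCriticalSpectrum {α β : List X} {p : X} {s : ℝ} (hs : 0 < s)
    (hα : IsEpsChain s α) (hβ : IsEpsChain s β) (hpα : α.head? = some p)
    (hpβ : β.head? = some p) (hn : ¬ EpsHomotopic s α β)
    (h : ∀ r, s < r → EpsHomotopic r α β) : s ∈ homotopyCriticalSpectrum X := by
  obtain ⟨x, hx⟩ : ∃ x, α.getLast? = some x := ⟨_, List.getLast?_eq_some_getLast hα.1⟩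
  have hxβ : β.getLast? = some x := by rw [← (h (s + 1) (by linarith)).getLast?_eq, hx]
  have hγ : IsEpsChain s (α.reverse ++ β) :=
    hα.reverse.append hs hβ (by rw [List.getLast?_reverse, hpα]) hpβ
  have hhead : (α.reverse ++ β).head? = some x := by
    simp [List.head?_append, List.head?_reverse, hx]
  refine ⟨hs, α.reverse ++ β, ⟨hγ, ?_⟩, ?_, ?_⟩
  · rw [hhead, List.getLast?_append, hxβ]; rfl
  · rintro ⟨y, hy, hnull⟩
    obtain rfl : x = y := by rw [hhead] at hy; simpa using hy
    apply hn
    -- Bracketing `α α⁻¹ β` in the two possible ways reduces it to `α` or to `β`.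
    have hc : IsEpsChain s (α ++ (α.reverse ++ β)) := hα.append hs hγ hx hhead
    have h1 := (hnull.append_left α hc).trans (epsHomotopic_append_singleton hs hα hx)
    rw [← List.append_assoc] at hc h1
    exact h1.symm.trans (((epsHomotopic_append_reverse hs hα hpα).append_right β hc).trans
      (epsHomotopic_singleton_append hs hβ hpβ))
  · intro δ hδ
    exact ⟨x, hhead, (((h δ hδ).symm.append_left _ (hγ.mono hδ.le))).trans
      (epsHomotopic_reverse_append (hs.trans hδ) (hα.mono hδ.le) hx)⟩

theorem coverMap_injective_iff {p : X} {δ ε : ℝ} (h : δ ≤ ε) :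
    Function.Injective (coverMap p h) ↔ ∀ α β : ChainFrom p δ,
      EpsHomotopic ε α.1 β.1 → EpsHomotopic δ α.1 β.1 := by
  constructor
  · intro hi α β hαβ
    have h1 : coverMap p h (Quotient.mk (chainSetoid p δ) α) =
        coverMap p h (Quotient.mk (chainSetoid p δ) β) :=
      Quotient.sound (s := chainSetoid p ε) hαβ
    exact Quotient.exact (s := chainSetoid p δ) (hi h1)
  · intro hi a b
    refine Quotient.inductionOn₂ a b fun α β hab => ?_
    exact Quotient.sound (s := chainSetoid p δ)
      (hi α β (Quotient.exact (s := chainSetoid p ε) hab))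

/-! ### Subdivision in spaces with midpoints -/

/-- `m` selects for any two points an approximate midpoint. -/
def IsMidpointMap (m : X → X → X) : Prop :=
  ∀ x y, dist x (m x y) ≤ dist x y / 2 ∧ dist (m x y) y ≤ dist x y / 2

theorem IsGeodesicSpace.exists_isMidpointMap (hX : IsGeodesicSpace X) :
    ∃ m : X → X → X, IsMidpointMap m := by
  have key : ∀ x y : X, ∃ z, dist x z ≤ dist x y / 2 ∧ dist z y ≤ dist x y / 2 := by
    intro x y
    obtain ⟨L, γ, hL, -, rfl, rfl, hu, hv⟩ := hX x y
    have hu' : ∀ a ∈ Set.Icc 0 L, ∀ b ∈ Set.Icc 0 L, a ≤ b → dist (γ a) (γ b) ≤ b - a := by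
      intro a ha b hb hab
      have h1 := hasConstantSpeedOnWith_iff_ordered.1 hu ha hb hab
      have h2 : edist (γ a) (γ b) ≤ ENNReal.ofReal (b - a) := by
        refine (eVariationOn.edist_le γ (s := Set.Icc 0 L ∩ Set.Icc a b)
          ⟨ha, le_rfl, hab⟩ ⟨hb, hab, le_rfl⟩).trans ?_
        simpa using h1.le
      rw [edist_dist] at h2
      exact (ENNReal.ofReal_le_ofReal_iff (by linarith)).1 h2
    -- The variation over the whole interval is `L` by unit speed and the distance by hypothesis.
    have hL' : dist (γ 0) (γ L) = L := by
      have h1 := hasConstantSpeedOnWith_iff_ordered.1 hu ⟨le_rfl, hL⟩ ⟨hL, le_rfl⟩ hL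
      rw [Set.inter_self, hv, edist_dist] at h1
      have := (ENNReal.ofReal_eq_ofReal_iff dist_nonneg (by simpa using hL)).1 h1
      simpa using this
    refine ⟨γ (L / 2), ?_, ?_⟩
    · have := hu' 0 ⟨le_rfl, hL⟩ (L / 2) ⟨by linarith, by linarith⟩ (by linarith)
      linarith
    · have := hu' (L / 2) ⟨by linarith, by linarith⟩ L ⟨hL, le_rfl⟩ (by linarith)
      linarith
  choose m hm using key
  exact ⟨m, hm⟩

theorem IsEpsChain.subdivide (hm : IsMidpointMap m) {α : List X} (h : IsEpsChain ε α) :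
    IsEpsChain (ε / 2) (subdivide m α) := by
  induction α with
  | nil => exact absurd rfl h.1
  | cons x l ih =>
    cases l with
    | nil => exact isEpsChain_singleton x
    | cons y l =>
      obtain ⟨hxy, hl⟩ := isEpsChain_cons_cons.1 h
      have ih := ih hl
      obtain ⟨l', hl'⟩ := exists_subdivide_eq_cons m y l
      rw [DiscreteHomotopy.subdivide, hl']
      rw [hl'] at ih
      exact isEpsChain_cons_cons.2 ⟨by linarith [(hm x y).1],
        isEpsChain_cons_cons.2 ⟨by linarith [(hm x y).2], ih⟩⟩

theorem epsHomotopic_subdivide (hm : IsMidpointMap m) (hε : 0 < ε) {α : List X}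
    (h : IsEpsChain ε α) : EpsHomotopic ε (subdivide m α) α := by
  induction α with
  | nil => exact absurd rfl h.1
  | cons x l ih =>
    cases l with
    | nil => exact .refl _
    | cons y l =>
      obtain ⟨hxy, hl⟩ := isEpsChain_cons_cons.1 h
      have hc := (h.subdivide hm).mono (show ε / 2 ≤ ε by linarith)
      rw [subdivide] at hc ⊢
      have h1 := (ih hl).append_left [x, m x y] hc
      exact h1.trans (epsHomotopic_remove (h1.isEpsChain hc) hxy)

/-- Halve repeatedly: each subdivision stays in the `ε`-class, because all scales `ε / 2 ^ n` are at
most `ε`. -/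
theorem exists_fine_chain (hm : IsMidpointMap m) {δ : ℝ} (hδ : 0 < δ) (hε : 0 < ε) {α : List X}
    (h : IsEpsChain ε α) : ∃ β, IsEpsChain δ β ∧ EpsHomotopic ε β α := by
  have key : ∀ n : ℕ, ∃ β, IsEpsChain (ε / 2 ^ n) β ∧ EpsHomotopic ε β α := by
    intro n
    induction n with
    | zero => exact ⟨α, by simpa using h, .refl _⟩
    | succ n ih =>
      obtain ⟨β, hβ, hh⟩ := ih
      have hle : ε / 2 ^ n ≤ ε := div_le_self hε.le (one_le_pow₀ one_le_two)
      refine ⟨subdivide m β, ?_, (epsHomotopic_subdivide hm hε (hβ.mono hle)).trans hh⟩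
      have := hβ.subdivide hm
      rwa [div_div, ← pow_succ] at this
  obtain ⟨n, hn⟩ := pow_unbounded_of_one_lt (ε / δ) (one_lt_two (α := ℝ))
  obtain ⟨β, hβ, hh⟩ := key n
  refine ⟨β, hβ.mono ?_, hh⟩
  rw [div_lt_iff₀ hδ] at hn
  rw [div_le_iff₀ (by positivity)]
  linarith

theorem coverMap_surjective (hm : IsMidpointMap m) (p : X) {δ ε : ℝ} (hδ : 0 < δ) (h : δ ≤ ε) :
    Function.Surjective (coverMap p h) := by
  intro a
  refine Quotient.inductionOn a fun α => ?_
  obtain ⟨β, hβ, hh⟩ := exists_fine_chain hm hδ (hδ.trans_le h) α.2.1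
  exact ⟨Quotient.mk (chainSetoid p δ) ⟨β, hβ, hh.head?_eq.trans α.2.2⟩,
    Quotient.sound (s := chainSetoid p ε) hh⟩

theorem exists_chain (hm : IsMidpointMap m) (hε : 0 < ε) (x y : X) :
    ∃ α, IsEpsChain ε α ∧ α.head? = some x ∧ α.getLast? = some y := by
  have h : IsEpsChain (dist x y + 1) [x, y] :=
    isEpsChain_cons_cons.2 ⟨by linarith, isEpsChain_singleton y⟩
  obtain ⟨β, hβ, hh⟩ := exists_fine_chain hm hε (by positivity) h
  exact ⟨β, hβ, by simp [hh.head?_eq], by simp [hh.getLast?_eq]⟩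

/-! ### The critical spectrum is the closure of the homotopy critical spectrum -/

/-- With `c` a chain from `p` to the loop `γ`, the chains `cγ` and `c` are identified at every scale
above `ε`; if they were at `ε`, cancelling `c` would make `γ` null. -/
theorem homotopyCriticalSpectrum_subset (hm : IsMidpointMap m) (p : X) :
    homotopyCriticalSpectrum X ⊆ criticalSpectrum p := by
  rintro ε ⟨hε, γ, ⟨hγ, hloop⟩, hn, hnull⟩
  refine ⟨hε, ?_⟩
  rintro ⟨I, ⟨-, hIo, -, -, hbij⟩, hεI⟩
  obtain ⟨δ, hδ, hδI⟩ : ∃ δ, ε < δ ∧ δ ∈ I := by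
    have h1 : ∀ᶠ δ in nhdsWithin ε (Set.Ioi ε), δ ∈ I :=
      nhdsWithin_le_nhds (hIo.mem_nhds hεI)
    have h2 : ∀ᶠ δ in nhdsWithin ε (Set.Ioi ε), ε < δ := self_mem_nhdsWithin
    exact (h2.and h1).exists
  obtain ⟨x, hx, hh⟩ := hnull δ hδ
  have hx' : γ.getLast? = some x := hloop ▸ hx
  obtain ⟨c, hc, hcp, hcx⟩ := exists_chain hm hε p x
  have hcγ : IsEpsChain ε (c ++ γ) := hc.append hε hγ hcx hx
  have h1 : EpsHomotopic δ (c ++ γ) c := (hh.append_left c (hcγ.mono hδ.le)).trans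
    (epsHomotopic_append_singleton (hε.trans hδ) (hc.mono hδ.le) hcx)
  have h2 : EpsHomotopic ε (c ++ γ) c :=
    (coverMap_injective_iff hδ.le).1 (hbij ε hεI δ hδI hδ).1
      ⟨c ++ γ, hcγ, by simp [List.head?_append, hcp]⟩ ⟨c, hc, hcp⟩ h1
  have hcr : c.reverse.head? = some x := by rw [List.head?_reverse, hcx]
  have hcl : c.reverse.getLast? = some p := by rw [List.getLast?_reverse, hcp]
  have h3 : IsEpsChain ε (c.reverse ++ (c ++ γ)) :=
    hc.reverse.append hε hcγ hcl (by simp [List.head?_append, hcp])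
  have h4 := (h2.append_left _ h3).trans (epsHomotopic_reverse_append hε hc hcx)
  rw [← List.append_assoc] at h3 h4
  exact hn ⟨x, hx, (((epsHomotopic_reverse_append hε hc hcx).append_right γ h3).trans
    (epsHomotopic_singleton_append hε hγ hx)).symm.trans h4⟩

theorem closure_inter_subset_criticalSpectrum (hm : IsMidpointMap m) (p : X) :
    closure (homotopyCriticalSpectrum X) ∩ Set.Ioi 0 ⊆ criticalSpectrum p := by
  rintro ε ⟨hcl, hε⟩
  refine ⟨hε, ?_⟩
  rintro ⟨I, hI, hεI⟩
  obtain ⟨s, hsI, hs⟩ := mem_closure_iff.1 hcl I hI.2.1 hεI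
  exact (homotopyCriticalSpectrum_subset hm p hs).2 ⟨I, hI, hsI⟩

theorem criticalSpectrum_subset (hm : IsMidpointMap m) (p : X) :
    criticalSpectrum p ⊆ closure (homotopyCriticalSpectrum X) ∩ Set.Ioi 0 := by
  rintro ε ⟨hε, hn⟩
  refine ⟨?_, hε⟩
  by_contra hcl
  obtain ⟨a, b, hab, hsub⟩ := mem_nhds_iff_exists_Ioo_subset.1
    (Filter.inter_mem (isClosed_closure.isOpen_compl.mem_nhds hcl) (Ioi_mem_nhds hε))
  refine hn ⟨Set.Ioo a b, ⟨⟨ε, hab⟩, isOpen_Ioo, Set.ordConnected_Ioo,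
    fun x hx => (hsub hx).2, ?_⟩, hab⟩
  intro δ hδ t ht hδt
  have hδ0 : 0 < δ := (hsub hδ).2
  refine ⟨(coverMap_injective_iff _).2 fun α β hαβ => ?_, coverMap_surjective hm p hδ0 hδt.le⟩
  by_contra hne
  obtain ⟨s, hδs, hst, hs, hs'⟩ := exists_critical_scale hαβ hne
  refine (hsub ⟨hδ.1.trans_le hδs, hst.trans ht.2⟩).1 (subset_closure ?_)
  exact mem_homotopyCriticalSpectrum (hδ0.trans_le hδs) (α.2.1.mono hδs) (β.2.1.mono hδs)
    α.2.2 β.2.2 hs hs'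

/-! ### Compact spaces -/

/-- Every triangle with sides `< t` is vertexwise `η`-close to one with sides `< s`. -/
def TrianglesApprox (X : Type*) [MetricSpace X] (η s t : ℝ) : Prop :=
  ∀ x y z : X, dist x y < t → dist y z < t → dist x z < t →
    ∃ x' y' z', dist x x' < η ∧ dist y y' < η ∧ dist z z' < η ∧
      dist x' y' < s ∧ dist y' z' < s ∧ dist x' z' < s

/-- Both chains are obtained from `x, x', m x y, y', y`. The longest step is below `(s + 2η)/2 + η =
s/2 + 2η`, whence `4η ≤ s`. -/
theorem epsHomotopic_midpoint (hm : IsMidpointMap m) {η s : ℝ} (hη : 4 * η ≤ s)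
    {x y x' y' : X} (hx : dist x x' < η) (hy : dist y y' < η) (hxy : dist x' y' < s) :
    EpsHomotopic s [x, m x y, y] [x, x', y', y] := by
  have h1 := hm x y
  have h2 : dist x y < s + 2 * η := by
    have := dist_triangle4 x x' y' y
    rw [dist_comm y' y] at this
    linarith
  have hη0 : 0 < η := dist_nonneg.trans_lt hx
  have hxm : dist x (m x y) < s := by linarith
  have hmy : dist (m x y) y < s := by linarith
  have hx'm : dist x' (m x y) < s := by
    have := dist_triangle x' x (m x y)
    rw [dist_comm x' x] at this
    linarith
  have hmy' : dist (m x y) y' < s := by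
    have := dist_triangle (m x y) y y'
    linarith
  have hyy : dist y' y < s := by rw [dist_comm]; linarith
  have hxx : dist x x' < s := by linarith
  have hc : IsEpsChain s [x, x', m x y, y', y] := by
    simp [isEpsChain_cons_cons, isEpsChain_singleton, *]
  have e1 : EpsHomotopic s [x, x', m x y, y', y] [x, m x y, y', y] :=
    epsHomotopic_remove hc hxm
  have e2 : EpsHomotopic s [x, m x y, y', y] [x, m x y, y] :=
    (epsHomotopic_remove (isEpsChain_cons_cons.1 (e1.isEpsChain hc)).2 hmy).cons x
      (e1.isEpsChain hc)
  have e3 : EpsHomotopic s [x, x', m x y, y', y] [x, x', y', y] :=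
    (epsHomotopic_remove (isEpsChain_cons_cons.1 hc).2 hxy).cons x hc
  exact (e1.trans e2).symm.trans e3

theorem epsHomotopic_midpoint_triangle (hm : IsMidpointMap m) {η s t : ℝ} (hη : 4 * η ≤ s)
    (h : TrianglesApprox X η s t) {x y z : X} (hxy : dist x y < t) (hxz : dist x z < t)
    (hzy : dist z y < t) :
    EpsHomotopic s [x, m x y, y] [x, m x z, z, m z y, y] := by
  obtain ⟨x', z', y', hx, hz, hy, hxz', hzy', hxy'⟩ := h x z y hxz hzy hxy
  have hη0 : 0 < η := dist_nonneg.trans_lt hx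
  have hxx : dist x x' < s := by linarith
  have hzz : dist z z' < s := by linarith
  have hzz' : dist z' z < s := by rwa [dist_comm]
  have hyy : dist y' y < s := by rw [dist_comm]; linarith
  have hs0 : 0 < s := by linarith
  -- The detour through `z` contracts across the small triangle `x' z' y'`; read in two halves, the
  -- same chain is the subdivided path through `z`.
  have hc : IsEpsChain s [x, x', z', z, z', y', y] := by
    simp [isEpsChain_cons_cons, isEpsChain_singleton, *]
  have e1 : EpsHomotopic s [x, x', z', z, z', y', y] [x, x', z', y', y] := by
    have hc2 : IsEpsChain s [z', z, z', y', y] := by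
      simp [isEpsChain_cons_cons, isEpsChain_singleton, *]
    have a := epsHomotopic_remove hc2 (by simpa using hs0)
    exact (a.trans (epsHomotopic_dup (a.isEpsChain hc2))).append_left [x, x'] hc
  have hc3 : IsEpsChain s [x, x', z', y', y] := e1.isEpsChain hc
  have e2 : EpsHomotopic s [x, x', z', y', y] [x, x', y', y] :=
    (epsHomotopic_remove (isEpsChain_cons_cons.1 hc3).2 hxy').cons x hc3
  have f1 : EpsHomotopic s [x, x', z', z, z', y', y] [x, m x z, z, z', y', y] :=
    (epsHomotopic_midpoint hm hη hx hz hxz').symm.append_right [z', y', y] hc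
  have f2 : EpsHomotopic s [x, m x z, z, z', y', y] [x, m x z, z, m z y, y] :=
    (epsHomotopic_midpoint hm hη hz hy hzy').symm.append_left [x, m x z] (f1.isEpsChain hc)
  exact (epsHomotopic_midpoint hm hη hx hy hxy').trans
    ((e1.trans e2).symm.trans (f1.trans f2))

theorem epsHomotopic_subdivide_dup (hm : IsMidpointMap m) {s t : ℝ} (hst : t / 2 ≤ s)
    (hs : 0 < s) {x : X} {l : List X} (hc : IsEpsChain t (x :: x :: l)) :
    EpsHomotopic s (subdivide m (x :: x :: l)) (subdivide m (x :: l)) := by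
  have hc' := (hc.subdivide hm).mono hst
  obtain ⟨l', hl'⟩ := exists_subdivide_eq_cons m x l
  rw [subdivide, hl'] at hc' ⊢
  have h := epsHomotopic_remove hc' (by simpa using hs)
  exact h.trans (epsHomotopic_dup (h.isEpsChain hc'))

theorem epsHomotopic_subdivide_insert (hm : IsMidpointMap m) {η s t : ℝ} (hη : 4 * η ≤ s)
    (hs : 0 < s) (hst : t / 2 ≤ s) (h : TrianglesApprox X η s t) (x z : X) (l₁ l₂ : List X)
    (hα : IsEpsChain t (x :: (l₁ ++ l₂))) (hβ : IsEpsChain t (x :: (l₁ ++ z :: l₂)))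
    (hl : (x :: (l₁ ++ l₂)).getLast? = (x :: (l₁ ++ z :: l₂)).getLast?) :
    EpsHomotopic s (subdivide m (x :: (l₁ ++ l₂))) (subdivide m (x :: (l₁ ++ z :: l₂))) := by
  induction l₁ generalizing x with
  | nil =>
    cases l₂ with
    | nil =>
      obtain rfl : x = z := by simpa using hl
      exact (epsHomotopic_subdivide_dup hm hst hs hβ).symm
    | cons y l =>
      have hc := (hα.subdivide hm).mono hst
      obtain ⟨l', hl'⟩ := exists_subdivide_eq_cons m y l
      simp only [List.nil_append, subdivide, hl', isEpsChain_cons_cons] at hc hα hβ ⊢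
      have hd := hc
      simp only [← isEpsChain_cons_cons] at hd
      exact (epsHomotopic_midpoint_triangle hm hη h hα.1 hβ.1 hβ.2.1).append_right l' hd
  | cons y l₁ ih =>
    have hc := (hα.subdivide hm).mono hst
    simp only [List.cons_append, subdivide] at hc ⊢
    refine EpsHomotopic.append_left (ih y (isEpsChain_cons_cons.1 hα).2
      (isEpsChain_cons_cons.1 hβ).2 ?_) [x, m x y] hc
    simpa [List.getLast?_cons_cons] using hl

theorem AddsPoint.subdivide (hm : IsMidpointMap m) {η s t : ℝ} (hη : 4 * η ≤ s)
    (hs : 0 < s) (hst : t / 2 ≤ s) (h : TrianglesApprox X η s t) {α β : List X}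
    (hα : IsEpsChain t α) (hβ : IsEpsChain t β) (hαβ : AddsPoint α β) :
    EpsHomotopic s (subdivide m α) (subdivide m β) := by
  obtain ⟨⟨l₁, l₂, z, rfl, rfl⟩, hh, hl⟩ := hαβ
  cases l₁ with
  | nil =>
    cases l₂ with
    | nil => exact absurd rfl hα.1
    | cons y l =>
      -- Since endpoints are fixed, inserting at the front can only repeat the first point.
      obtain rfl : y = z := by simpa using hh
      exact (epsHomotopic_subdivide_dup hm hst hs hβ).symm
  | cons x l₁ => exact epsHomotopic_subdivide_insert hm hη hs hst h x z l₁ l₂ hα hβ hl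

/-- This is the descent from scale `t` to the smaller scale `s`: each basic move at scale `t`
becomes, after subdivision, a homotopy at scale `s`. -/
theorem EpsHomotopic.subdivide (hm : IsMidpointMap m) {η s t : ℝ} (hη : 4 * η ≤ s)
    (hs : 0 < s) (hst : t / 2 ≤ s) (h : TrianglesApprox X η s t) {α β : List X}
    (hαβ : EpsHomotopic t α β) :
    EpsHomotopic s (subdivide m α) (subdivide m β) := by
  induction hαβ with
  | refl => exact .refl _
  | tail _ hmv ih =>
    refine ih.trans ?_
    rcases hmv.2.2 with ha | ha
    · exact ha.subdivide hm hη hs hst h hmv.1 hmv.2.1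
    · exact (ha.subdivide hm hη hs hst h hmv.2.1 hmv.1).symm

/-- As an `s`-chain, `γ` is `s`-homotopic to its subdivision, and a one-point loop subdivides to
itself. -/
theorem IsEpsNull.of_trianglesApprox (hm : IsMidpointMap m) {η s t : ℝ} (hη : 4 * η ≤ s)
    (hs : 0 < s) (hst : t / 2 ≤ s) (h : TrianglesApprox X η s t) {γ : List X}
    (hγ : IsEpsChain s γ) (hn : IsEpsNull t γ) : IsEpsNull s γ := by
  obtain ⟨x, hx, hh⟩ := hn
  exact ⟨x, hx, (epsHomotopic_subdivide hm hs hγ).symm.trans (hh.subdivide hm hη hs hst h)⟩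

/-! ### Finiteness of the homotopy critical spectrum away from zero. -/

theorem homotopyCriticalSpectrum_inter_Ici_finite [CompactSpace X] (hm : IsMidpointMap m) {a : ℝ}
    (ha : 0 < a) : (homotopyCriticalSpectrum X ∩ Set.Ici a).Finite := by
  obtain ⟨N, hN, hcov⟩ := Metric.totallyBounded_iff.1
    (isCompact_univ (X := X)).totallyBounded (a / 8) (by positivity)
  have : Finite N := hN
  have hnear : ∀ x : X, ∃ u : N, dist x u < a / 8 := by
    intro x
    have := hcov (Set.mem_univ x)
    simp only [Set.mem_iUnion, Metric.mem_ball] at this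
    obtain ⟨u, hu, hxu⟩ := this
    exact ⟨⟨u, hu⟩, hxu⟩
  let T : ℝ → Set (N × N × N) := fun s => {u | ∃ x y z : X, dist x u.1 < a / 8 ∧
    dist y u.2.1 < a / 8 ∧ dist z u.2.2 < a / 8 ∧ dist x y < s ∧ dist y z < s ∧ dist x z < s}
  have key : ∀ s ∈ homotopyCriticalSpectrum X ∩ Set.Ici a,
      ∀ t ∈ homotopyCriticalSpectrum X ∩ Set.Ici a, T s = T t → ¬ s < t := by
    rintro s ⟨⟨hs, γ, hγ, hn, hnull⟩, has⟩ t - hT hst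
    rw [Set.mem_Ici] at has
    have happ : TrianglesApprox X (a / 4) s t := by
      intro x y z hxy hyz hxz
      obtain ⟨u, hu⟩ := hnear x
      obtain ⟨v, hv⟩ := hnear y
      obtain ⟨w, hw⟩ := hnear z
      have hmem : (u, v, w) ∈ T t := ⟨x, y, z, hu, hv, hw, hxy, hyz, hxz⟩
      rw [← hT] at hmem
      obtain ⟨x', y', z', hu', hv', hw', h1, h2, h3⟩ := hmem
      have close : ∀ {b c d : X}, dist b d < a / 8 → dist c d < a / 8 → dist b c < a / 4 := by
        intro b c d hb hc
        have := dist_triangle_right b c d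
        linarith
      exact ⟨x', y', z', close hu hu', close hv hv', close hw hw', h1, h2, h3⟩
    -- `r ≤ 2 * s` makes subdivided `r`-chains into `s`-chains; `r ≤ t` keeps the triangle
    -- approximation.
    obtain ⟨r, hsr, hrt⟩ : ∃ r, s < r ∧ r ≤ min t (2 * s) :=
      ⟨min t (2 * s), by simp [hst, hs], le_rfl⟩
    have hrt' := hrt.trans (min_le_left _ _)
    have hr2 := hrt.trans (min_le_right _ _)
    exact hn ((hnull r hsr).of_trianglesApprox hm (by linarith) hs (by linarith)
      (fun x y z h1 h2 h3 => happ x y z (h1.trans_le hrt') (h2.trans_le hrt') (h3.trans_le hrt'))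
      hγ.1)
  refine Set.Finite.of_finite_image (f := T) (Set.toFinite _) ?_
  intro s hs t ht hT
  exact le_antisymm (not_lt.1 (key t ht s hs hT.symm)) (not_lt.1 (key s hs t ht hT))

theorem closure_homotopyCriticalSpectrum_inter [CompactSpace X] (hm : IsMidpointMap m) :
    closure (homotopyCriticalSpectrum X) ∩ Set.Ioi 0 = homotopyCriticalSpectrum X := by
  apply Set.Subset.antisymm
  · rintro ε ⟨hcl, hε⟩
    rw [Set.mem_Ioi] at hε
    have hfin := homotopyCriticalSpectrum_inter_Ici_finite hm (half_pos hε)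
    -- Near `ε` only points above `ε / 2` matter, and these form a finite, hence closed, set.
    have h1 : ε ∈ closure (homotopyCriticalSpectrum X ∩ Set.Ici (ε / 2)) := by
      rw [mem_closure_iff_nhds] at hcl ⊢
      intro U hU
      obtain ⟨r, ⟨hrU, hr⟩, hrH⟩ :=
        hcl _ (Filter.inter_mem hU (Ici_mem_nhds (show ε / 2 < ε by linarith)))
      exact ⟨r, hrU, hrH, hr⟩
    rw [hfin.isClosed.closure_eq] at h1
    exact h1.1
  · exact fun ε h => ⟨subset_closure h, h.1⟩

end DiscreteHomotopy

theorem mainTheorem6 {X : Type*} [MetricSpace X] (hX : DiscreteHomotopy.IsGeodesicSpace X)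
    (p : X) :
    DiscreteHomotopy.criticalSpectrum p =
        closure (DiscreteHomotopy.homotopyCriticalSpectrum X) ∩ Set.Ioi 0 ∧
      (CompactSpace X →
        DiscreteHomotopy.criticalSpectrum p = DiscreteHomotopy.homotopyCriticalSpectrum X) := by
  obtain ⟨m, hm⟩ := hX.exists_isMidpointMap
  have h : DiscreteHomotopy.criticalSpectrum p =
      closure (DiscreteHomotopy.homotopyCriticalSpectrum X) ∩ Set.Ioi 0 :=
    (DiscreteHomotopy.criticalSpectrum_subset hm p).antisymm
      (DiscreteHomotopy.closure_inter_subset_criticalSpectrum hm p)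
  exact ⟨h, fun _ => h.trans (DiscreteHomotopy.closure_homotopyCriticalSpectrum_inter hm)⟩
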